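/- Let $k$ be a field. For a $k$-bialgebra $B$ let the finite dual $B^\circ$ be the space of all linear functionals $f\colon B\to k$ that vanish on some two-sided ideal of finite codimension in $B$. It is a bialgebra with product $(fg)(b)=f(b_1)g(b_2)$, unit $\varepsilon_B$, counit $f\mapsto f(1)$, and comultiplication $\Delta f=f_1\otimes f_2$ determined by $f(ab)=f_1(a)f_2(b)$ for all $a,b\in B$. A bialgebra map $\varphi\colon B\to C$ induces the bialgebra map $\varphi^\circ\colon C^\circ\to B^\circ$, $f\mapsto f\circ\varphi$, and so $B\mapsto B^\circ$ is a contravariant functor from the category of $k$-bialgebras to itself. For bialgebras $N,T$ and a $k$-algebra $A$, a linear map $\psi\colon N\otimes T\to A$ is called a bimeasuring if $\psi(nm,t)=\psi(n,t_1)\psi(m,t_2)$, $\psi(1,t)=\varepsilon(t)1$, $\psi(n,ts)=\psi(n_1,t)\psi(n_2,s)$ and $\psi(n,1)=\varepsilon(n)1$ for all $n,m\in N$ and $t,s\in T$. Then: 1. For every bialgebra $B$, the evaluation map $\theta\colon B^\circ\otimes B\to k$, $\theta(f,b)=f(b)$, is the universal bimeasuring, i.e. $B^\circ=B(B,k)$: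 it is a bimeasuring, and for every bialgebra $N$ and every bimeasuring $\psi\colon N\otimes B\to k$ there is a unique bialgebra map $\overline{\psi}\colon N\to B^\circ$ with $\psi=\theta(\overline{\psi}\otimes 1)$. 2. The contravariant functor $B\mapsto B^\circ$ is adjoint to itself: there is a bijection $\operatorname{Bialg}(T,N^\circ)\cong\operatorname{Bialg}(N,T^\circ)$, natural in the bialgebras $N$ and $T$, that sends $f$ to the map $\overline{f}$ given by $\overline{f}(n)(t)=f(t)(n)$ for $n\in N$, $t\in T$. -/

import Mathlib

open CategoryTheory
open scoped TensorProduct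

universe u v w

/-! ### The finite dual of an algebra -/

section RepresentativeFunctionals

variable {k : Type u} [Field k]

/-- A linear functional on an algebra `B` is *representative* if it vanishes on a two-sided ideal
of finite codimension. -/
def IsRepresentative {B : Type v} [Ring B] [Algebra k B] (f : Module.Dual k B) : Prop :=
  ∃ I : Ideal B, I.IsTwoSided ∧ FiniteDimensional k (B ⧸ I.restrictScalars k) ∧
    ∀ b ∈ I, f b = 0

/-- A functional that factors through an algebra map to a finite-dimensional algebra is
representative. -/
theorem IsRepresentative.of_factor {B : Type v} [Ring B] [Algebra k B] {E : Type w} [Ring E]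
    [Algebra k E] [FiniteDimensional k E] (φ : B →ₐ[k] E) (f : Module.Dual k B)
    (h : ∀ b, φ b = 0 → f b = 0) : IsRepresentative f := by
  refine ⟨RingHom.ker φ, inferInstance, ?_, fun b hb => h b hb⟩
  have e : (RingHom.ker φ).restrictScalars k = LinearMap.ker φ.toLinearMap := by
    ext x; rfl
  rw [e]
  exact Module.Finite.equiv (φ.toLinearMap.quotKerEquivRange).symm

/-- A representative functional factors through a finite-dimensional quotient algebra. -/
theorem IsRepresentative.exists_factor {B : Type v} [Ring B] [Algebra k B] {f : Module.Dual k B}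
    (hf : IsRepresentative f) : ∃ (E : Type v) (_ : Ring E) (_ : Algebra k E)
      (_ : FiniteDimensional k E) (φ : B →ₐ[k] E) (g : Module.Dual k E),
      f = g ∘ₗ φ.toLinearMap := by
  obtain ⟨I, hI, hfin, h⟩ := hf
  have : FiniteDimensional k (B ⧸ I) := hfin
  refine ⟨B ⧸ I, inferInstance, inferInstance, this, Ideal.Quotient.mkₐ k I,
    (I.restrictScalars k).liftQ f (fun b hb => h b hb), ?_⟩
  ext b
  rfl

end RepresentativeFunctionals

/-! ### The finite dual of a bialgebra -/

section FiniteDual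

variable (k : Type u) [Field k]

/-- The finite dual `B°` of a bialgebra, as a subalgebra of the full dual `B → k` with its
convolution product `(f * g)(b) = f(b₁) g(b₂)` and unit `ε`. -/
noncomputable def finiteDualSubalgebra (B : Type v) [Ring B] [Bialgebra k B] : Subalgebra k (WithConv (B →ₗ[k] k)) where
  carrier := {f | IsRepresentative f.ofConv}
  mul_mem' := by
    intro f g hf hg
    obtain ⟨E, _, _, _, φ, f', hf'⟩ := IsRepresentative.exists_factor hf
    obtain ⟨E', _, _, _, φ', g', hg'⟩ := IsRepresentative.exists_factor hg
    refine IsRepresentative.of_factor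
      ((Algebra.TensorProduct.map φ φ').comp (Bialgebra.comulAlgHom k B)) _ fun b hb => ?_
    have h2 : TensorProduct.map f.ofConv g.ofConv =
        TensorProduct.map f' g' ∘ₗ TensorProduct.map φ.toLinearMap φ'.toLinearMap := by
      rw [hf', hg', TensorProduct.map_comp]
    have hb' : TensorProduct.map φ.toLinearMap φ'.toLinearMap (Coalgebra.comul (R := k) b) = 0 := hb
    change (f * g) b = 0
    rw [LinearMap.convMul_apply, h2, LinearMap.comp_apply, hb', map_zero, map_zero]
  add_mem' := by
    intro f g hf hg
    obtain ⟨E, _, _, _, φ, f', hf'⟩ := IsRepresentative.exists_factor hf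
    obtain ⟨E', _, _, _, φ', g', hg'⟩ := IsRepresentative.exists_factor hg
    refine IsRepresentative.of_factor (φ.prod φ') _ fun b hb => ?_
    have hb' : φ b = 0 ∧ φ' b = 0 := Prod.ext_iff.1 hb
    simp [hf', hg', hb'.1, hb'.2]
  algebraMap_mem' := by
    intro r
    refine IsRepresentative.of_factor (Bialgebra.counitAlgHom k B) _ fun b hb => ?_
    have hb' : Coalgebra.counit (R := k) b = 0 := hb
    change algebraMap k (WithConv (B →ₗ[k] k)) r b = 0
    rw [LinearMap.convAlgebraMap_apply, hb', map_zero, smul_zero]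

/-- The finite dual `B°` of a bialgebra `B` over `k`. -/
def FiniteDual (B : Type v) [Ring B] [Bialgebra k B] : Type (max u v) :=
  finiteDualSubalgebra k B

namespace FiniteDual

variable (B : Type v) [Ring B] [Bialgebra k B]

noncomputable instance : Ring (FiniteDual k B) :=
  inferInstanceAs (Ring (finiteDualSubalgebra k B))

noncomputable instance : Algebra k (FiniteDual k B) :=
  inferInstanceAs (Algebra k (finiteDualSubalgebra k B))

/-- The inclusion of the finite dual into the linear dual. Its value `toDual k B f b` is the
evaluation `f(b)`, so this is the evaluation pairing `B° × B → k`. -/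
noncomputable def toDual : FiniteDual k B →ₗ[k] B →ₗ[k] k :=
  (WithConv.linearEquiv k (B →ₗ[k] k)).toLinearMap ∘ₗ (finiteDualSubalgebra k B).val.toLinearMap

variable {k B}

theorem toDual_injective : Function.Injective (toDual k B) :=
  (WithConv.linearEquiv k (B →ₗ[k] k)).injective.comp Subtype.val_injective

theorem ext' {f g : FiniteDual k B} (h : ∀ b, toDual k B f b = toDual k B g b) : f = g :=
  toDual_injective (LinearMap.ext h)

theorem isRepresentative (f : FiniteDual k B) : IsRepresentative (toDual k B f) := f.2

theorem toDual_one (b : B) : toDual k B 1 b = Coalgebra.counit b := rfl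

theorem toDual_mul (f g : FiniteDual k B) (b : B) : toDual k B (f * g) b =
    LinearMap.mul' k k (TensorProduct.map (toDual k B f) (toDual k B g) (Coalgebra.comul b)) := rfl

/-- The representative functional `f` as an element of the finite dual. -/
def mk (f : Module.Dual k B) (hf : IsRepresentative f) : FiniteDual k B :=
  ⟨WithConv.toConv f, hf⟩

@[simp]
theorem toDual_mk (f : Module.Dual k B) (hf : IsRepresentative f) : toDual k B (mk f hf) = f := rfl

/-- Two injective families of functionals induce an injective family on the tensor product. -/
theorem dualDistrib_map_injective {V : Type*} {W : Type*} {X : Type*} {Y : Type*}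
    [AddCommGroup V] [Module k V] [AddCommGroup W] [Module k W] [AddCommGroup X] [Module k X]
    [AddCommGroup Y] [Module k Y] (p : V →ₗ[k] Module.Dual k X) (q : W →ₗ[k] Module.Dual k Y)
    (hp : Function.Injective p) (hq : Function.Injective q) :
    Function.Injective (TensorProduct.dualDistrib k X Y ∘ₗ TensorProduct.map p q) := by
  rw [injective_iff_map_eq_zero]
  intro z hz
  classical
  let β := Module.Basis.ofVectorSpace k V
  obtain ⟨c, rfl⟩ := (TensorProduct.equivFinsuppOfBasisLeft (N := W) β).symm.surjective z
  have hc : c = 0 := by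
    ext i
    refine hq ?_
    rw [Finsupp.zero_apply, map_zero]
    ext y
    have h1 : p (c.sum fun i m => q m y • β i) = 0 := by
      ext x
      have h := LinearMap.congr_fun hz (x ⊗ₜ[k] y)
      rw [TensorProduct.equivFinsuppOfBasisLeft_symm_apply] at h
      simp only [Finsupp.sum, map_sum, LinearMap.comp_apply, TensorProduct.map_tmul,
        LinearMap.sum_apply, TensorProduct.dualDistrib_apply, LinearMap.zero_apply, map_smul,
        LinearMap.smul_apply, smul_eq_mul] at h ⊢
      rw [← h]
      exact Finset.sum_congr rfl fun _ _ => mul_comm _ _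
    have h2 : (c.sum fun i m => q m y • β i) = 0 := hp (by rw [h1, map_zero])
    have h3 := congrArg (fun v => β.repr v i) h2
    simp only [Finsupp.sum, map_sum, map_smul, Module.Basis.repr_self, map_zero,
      Finsupp.coe_finsetSum, Finset.sum_apply, Finsupp.smul_apply, Finsupp.zero_apply,
      Finsupp.single_apply, smul_eq_mul, mul_ite, mul_one, mul_zero, Finset.sum_ite_eq',
      Finsupp.mem_support_iff] at h3
    by_cases hi : c i = 0
    · simp [hi]
    · simpa [hi] using h3
  rw [hc, map_zero]

variable (k B) in
/-- The canonical map `B° ⊗ B° → (B ⊗ B)*`, `(f ⊗ g)(a ⊗ b) = f(a) g(b)`. -/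
noncomputable def tensorToDual : FiniteDual k B ⊗[k] FiniteDual k B →ₗ[k] Module.Dual k (B ⊗[k] B) :=
  TensorProduct.dualDistrib k B B ∘ₗ TensorProduct.map (toDual k B) (toDual k B)

@[simp]
theorem tensorToDual_tmul (f g : FiniteDual k B) (a b : B) :
    tensorToDual k B (f ⊗ₜ g) (a ⊗ₜ b) = toDual k B f a * toDual k B g b := rfl

theorem tensorToDual_injective : Function.Injective (tensorToDual k B) :=
  dualDistrib_map_injective _ _ toDual_injective toDual_injective

theorem exists_tensorToDual_eq (f : FiniteDual k B) :
    ∃ z, tensorToDual k B z = toDual k B f ∘ₗ LinearMap.mul' k B := by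
  obtain ⟨E, _, _, _, φ, g, hg⟩ := (isRepresentative f).exists_factor
  let r : Module.Dual k E →ₗ[k] FiniteDual k B :=
    { toFun := fun h => mk (h ∘ₗ φ.toLinearMap) (IsRepresentative.of_factor φ _ fun b hb => by
        simp [hb])
      map_add' := fun _ _ => rfl
      map_smul' := fun _ _ => rfl }
  have key : ∀ y : Module.Dual k E ⊗[k] Module.Dual k E,
      tensorToDual k B (TensorProduct.map r r y) =
        TensorProduct.dualDistrib k E E y ∘ₗ TensorProduct.map φ.toLinearMap φ.toLinearMap := by
    intro y
    induction y with
    | zero => simp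
    | tmul a b => ext x y; rfl
    | add a b ha hb => rw [map_add, map_add, ha, hb, map_add, LinearMap.add_comp]
  refine ⟨TensorProduct.map r r
    ((TensorProduct.dualDistribEquiv k E E).symm (g ∘ₗ LinearMap.mul' k E)), ?_⟩
  rw [key]
  have : TensorProduct.dualDistrib k E E
      ((TensorProduct.dualDistribEquiv k E E).symm (g ∘ₗ LinearMap.mul' k E)) =
        g ∘ₗ LinearMap.mul' k E :=
    (TensorProduct.dualDistribEquiv k E E).apply_symm_apply _
  rw [this, hg]
  ext a b
  simp

variable (k B) in
/-- The comultiplication of `B°`: `Δ f` is the element of `B° ⊗ B°` that, as a functional on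
`B ⊗ B`, is `a ⊗ b ↦ f(ab)`. -/
noncomputable def comulMap : FiniteDual k B →ₗ[k] FiniteDual k B ⊗[k] FiniteDual k B :=
  (LinearEquiv.ofInjective (tensorToDual k B) tensorToDual_injective).symm.toLinearMap ∘ₗ
    LinearMap.codRestrict (LinearMap.range (tensorToDual k B))
      (LinearMap.lcomp k k (LinearMap.mul' k B) ∘ₗ toDual k B) exists_tensorToDual_eq

theorem tensorToDual_comulMap (f : FiniteDual k B) :
    tensorToDual k B (comulMap k B f) = toDual k B f ∘ₗ LinearMap.mul' k B :=
  LinearEquiv.ofInjective_symm_apply (tensorToDual k B) (h := tensorToDual_injective)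
    ⟨_, exists_tensorToDual_eq f⟩

variable (k B) in
/-- The counit of `B°`: evaluation at `1`. -/
noncomputable def counitMap : FiniteDual k B →ₗ[k] k := LinearMap.applyₗ (1 : B) ∘ₗ toDual k B

@[simp]
theorem counitMap_apply (f : FiniteDual k B) : counitMap k B f = toDual k B f 1 := rfl

variable (k B) in
/-- The canonical map `B° ⊗ (B° ⊗ B°) → (B ⊗ (B ⊗ B))*`. -/
noncomputable def tensorToDual₃ : FiniteDual k B ⊗[k] (FiniteDual k B ⊗[k] FiniteDual k B) →ₗ[k]
    Module.Dual k (B ⊗[k] (B ⊗[k] B)) :=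
  TensorProduct.dualDistrib k B (B ⊗[k] B) ∘ₗ
    TensorProduct.map (toDual k B) (tensorToDual k B)

theorem tensorToDual₃_injective : Function.Injective (tensorToDual₃ k B) :=
  dualDistrib_map_injective _ _ toDual_injective tensorToDual_injective

noncomputable instance : Coalgebra k (FiniteDual k B) where
  comul := comulMap k B
  counit := counitMap k B
  coassoc := by
    have h1 : ∀ (y : FiniteDual k B ⊗[k] FiniteDual k B) (g : FiniteDual k B) (a b c : B),
        tensorToDual₃ k B (TensorProduct.assoc k _ _ _ (y ⊗ₜ[k] g)) (a ⊗ₜ (b ⊗ₜ c)) =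
          tensorToDual k B y (a ⊗ₜ b) * toDual k B g c := by
      intro y g a b c
      induction y with
      | zero => simp
      | tmul p q => simp [tensorToDual₃, mul_assoc]
      | add p q hp hq => simp only [TensorProduct.add_tmul, map_add, LinearMap.add_apply, hp, hq,
          add_mul]
    have h2 : ∀ (z : FiniteDual k B ⊗[k] FiniteDual k B) (a b c : B),
        tensorToDual₃ k B (TensorProduct.assoc k _ _ _ ((comulMap k B).rTensor _ z))
          (a ⊗ₜ (b ⊗ₜ c)) = tensorToDual k B z ((a * b) ⊗ₜ c) := by
      intro z a b c
      induction z with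
      | zero => simp
      | tmul p q => rw [LinearMap.rTensor_tmul, h1, tensorToDual_comulMap]; simp
      | add p q hp hq => simp only [map_add, LinearMap.add_apply, hp, hq]
    have h3 : ∀ (z : FiniteDual k B ⊗[k] FiniteDual k B) (a b c : B),
        tensorToDual₃ k B ((comulMap k B).lTensor _ z) (a ⊗ₜ (b ⊗ₜ c)) =
          tensorToDual k B z (a ⊗ₜ (b * c)) := by
      intro z a b c
      induction z with
      | zero => simp
      | tmul p q =>
        rw [LinearMap.lTensor_tmul, tensorToDual₃, LinearMap.comp_apply, TensorProduct.map_tmul,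
          TensorProduct.dualDistrib_apply, tensorToDual_comulMap]
        simp
      | add p q hp hq => simp only [map_add, LinearMap.add_apply, hp, hq]
    refine LinearMap.ext fun f => tensorToDual₃_injective ?_
    refine TensorProduct.ext (LinearMap.ext fun a => TensorProduct.ext
      (LinearMap.ext fun b => LinearMap.ext fun c => ?_))
    have e2 := h2 (comulMap k B f) a b c
    have e3 := h3 (comulMap k B f) a b c
    rw [tensorToDual_comulMap] at e2 e3
    refine e2.trans (Eq.trans ?_ e3.symm)
    simp [mul_assoc]
  rTensor_counit_comp_comul := by
    have h : ∀ (z : FiniteDual k B ⊗[k] FiniteDual k B) (b : B),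
        toDual k B (TensorProduct.lid k _ ((counitMap k B).rTensor _ z)) b =
          tensorToDual k B z (1 ⊗ₜ b) := by
      intro z b
      induction z with
      | zero => simp
      | tmul p q => simp
      | add p q hp hq => simp only [map_add, LinearMap.add_apply, hp, hq]
    refine LinearMap.ext fun f => (TensorProduct.lid k (FiniteDual k B)).injective
      (ext' fun b => ?_)
    refine (h (comulMap k B f) b).trans ?_
    rw [tensorToDual_comulMap]
    simp
  lTensor_counit_comp_comul := by
    have h : ∀ (z : FiniteDual k B ⊗[k] FiniteDual k B) (b : B),
        toDual k B (TensorProduct.rid k _ ((counitMap k B).lTensor _ z)) b =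
          tensorToDual k B z (b ⊗ₜ 1) := by
      intro z b
      induction z with
      | zero => simp
      | tmul p q => simp [mul_comm]
      | add p q hp hq => simp only [map_add, LinearMap.add_apply, hp, hq]
    refine LinearMap.ext fun f => (TensorProduct.rid k (FiniteDual k B)).injective
      (ext' fun b => ?_)
    refine (h (comulMap k B f) b).trans ?_
    rw [tensorToDual_comulMap]
    simp

theorem counit_apply (f : FiniteDual k B) : Coalgebra.counit (R := k) f = toDual k B f 1 := rfl

theorem tensorToDual_comul (f : FiniteDual k B) (a b : B) :
    tensorToDual k B (Coalgebra.comul f) (a ⊗ₜ b) = toDual k B f (a * b) := by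
  have h := LinearMap.congr_fun (tensorToDual_comulMap f) (a ⊗ₜ b)
  rw [LinearMap.comp_apply, LinearMap.mul'_apply] at h
  exact h

theorem tensorToDual_one :
    WithConv.toConv (tensorToDual k B 1) = (1 : WithConv (B ⊗[k] B →ₗ[k] k)) := by
  ext a b
  simp [Algebra.TensorProduct.one_def, toDual_one, mul_comm]

theorem tensorToDual_mul (y z : FiniteDual k B ⊗[k] FiniteDual k B) :
    WithConv.toConv (tensorToDual k B (y * z)) =
      WithConv.toConv (tensorToDual k B y) * WithConv.toConv (tensorToDual k B z) := by
  induction y with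
  | zero => simp
  | add p q hp hq => rw [add_mul, map_add, WithConv.toConv_add, hp, hq, map_add,
      WithConv.toConv_add, add_mul]
  | tmul f g =>
    induction z with
    | zero => simp
    | add p q hp hq => rw [mul_add, map_add, WithConv.toConv_add, hp, hq, map_add,
        WithConv.toConv_add, mul_add]
    | tmul f' g' =>
      have e : ∀ p q : FiniteDual k B, tensorToDual k B (p ⊗ₜ q) =
          (Algebra.TensorProduct.lmul' k (S := k)).toLinearMap ∘ₗ
            TensorProduct.map (toDual k B p) (toDual k B q) := by
        intro p q
        ext a b
        simp
      have h := congrArg WithConv.toConv (LinearMap.algHom_comp_convMul_distrib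
        (Algebra.TensorProduct.lmul' k (S := k))
        (WithConv.toConv (TensorProduct.map (toDual k B f) (toDual k B g)))
        (WithConv.toConv (TensorProduct.map (toDual k B f') (toDual k B g'))))
      rw [TensorProduct.map_convMul_map] at h
      rw [Algebra.TensorProduct.tmul_mul_tmul, e, e, e]
      exact h

noncomputable instance : Bialgebra k (FiniteDual k B) :=
  Bialgebra.mk' k (FiniteDual k B)
    (by rw [counit_apply, toDual_one, Bialgebra.counit_one])
    (by
      intro f g
      rw [counit_apply, toDual_mul, Bialgebra.comul_one]
      simp [Algebra.TensorProduct.one_def, counit_apply])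
    (by
      refine tensorToDual_injective (WithConv.toConv_injective ?_)
      rw [tensorToDual_one]
      ext a b
      simp [tensorToDual_comul, toDual_one, mul_comm])
    (by
      intro f g
      refine tensorToDual_injective (WithConv.toConv_injective ?_)
      rw [tensorToDual_mul]
      have e : ∀ f : FiniteDual k B, tensorToDual k B (Coalgebra.comul f) =
          (toDual k B f) ∘ₗ (Bialgebra.mulCoalgHom k B).toLinearMap := by
        intro f
        ext a b
        simp [tensorToDual_comul]
      rw [e, e, e]
      exact congrArg WithConv.toConv (LinearMap.convMul_comp_coalgHom_distrib f.1 g.1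
        (Bialgebra.mulCoalgHom k B)))

/-- The transpose `f ↦ f ∘ φ` of a bialgebra map `φ : B → C`, as an algebra map `C° → B°`. -/
noncomputable def mapAlgHom {C : Type w} [Ring C] [Bialgebra k C] (φ : B →ₐc[k] C) :
    FiniteDual k C →ₐ[k] FiniteDual k B :=
  AlgHom.ofLinearMap
    { toFun := fun f => mk (toDual k C f ∘ₗ (φ : B →ₗc[k] C).toLinearMap) (by
        obtain ⟨E, _, _, _, ψ, g, hg⟩ := (isRepresentative f).exists_factor
        refine IsRepresentative.of_factor (ψ.comp (φ : B →ₐ[k] C)) _ fun b hb => ?_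
        have hb' : ψ (φ b) = 0 := hb
        rw [hg]
        change g (ψ (φ b)) = 0
        rw [hb', map_zero])
      map_add' := fun _ _ => rfl
      map_smul' := fun _ _ => rfl }
    (ext' fun b => by
      change Coalgebra.counit (R := k) (φ b) = Coalgebra.counit (R := k) b
      simp)
    (fun f g => toDual_injective
      (LinearMap.convMul_comp_coalgHom_distrib f.1 g.1 (φ : B →ₗc[k] C)))

theorem toDual_mapAlgHom {C : Type w} [Ring C] [Bialgebra k C] (φ : B →ₐc[k] C)
    (f : FiniteDual k C) (b : B) : toDual k B (mapAlgHom φ f) b = toDual k C f (φ b) := rfl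

/-- The bialgebra map `φ° : C° → B°`, `f ↦ f ∘ φ`, induced by a bialgebra map `φ : B → C`. -/
noncomputable def map {C : Type w} [Ring C] [Bialgebra k C] (φ : B →ₐc[k] C) :
    FiniteDual k C →ₐc[k] FiniteDual k B :=
  BialgHom.ofAlgHom (mapAlgHom φ)
    (by
      ext f
      change toDual k C f (φ 1) = toDual k C f 1
      rw [map_one])
    (by
      have h : ∀ (z : FiniteDual k C ⊗[k] FiniteDual k C) (a b : B),
          tensorToDual k B (Algebra.TensorProduct.map (mapAlgHom φ) (mapAlgHom φ) z) (a ⊗ₜ b) =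
            tensorToDual k C z (φ a ⊗ₜ φ b) := by
        intro z a b
        induction z with
        | zero => simp
        | tmul p q => rfl
        | add p q hp hq => simp only [map_add, LinearMap.add_apply, hp, hq]
      refine AlgHom.ext fun f => tensorToDual_injective
        (TensorProduct.ext (LinearMap.ext fun a => LinearMap.ext fun b => ?_))
      refine (h (Coalgebra.comul f) a b).trans ?_
      refine Eq.trans ?_ (tensorToDual_comul (mapAlgHom φ f) a b).symm
      rw [tensorToDual_comul, toDual_mapAlgHom, map_mul φ])

theorem toDual_map {C : Type w} [Ring C] [Bialgebra k C] (φ : B →ₐc[k] C)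
    (f : FiniteDual k C) (b : B) : toDual k B (map φ f) b = toDual k C f (φ b) := rfl

end FiniteDual

/-- The finite dual as a contravariant functor on the category of `k`-bialgebras,
`B ↦ B°` on objects and `φ ↦ (f ↦ f ∘ φ)` on morphisms. -/
noncomputable def finiteDualFunctor : (BialgCat.{max u v} k)ᵒᵖ ⥤ BialgCat.{max u v} k where
  obj B := BialgCat.of k (FiniteDual k B.unop)
  map φ := BialgCat.ofHom (FiniteDual.map φ.unop.toBialgHom)
  map_id _ := rfl
  map_comp _ _ := rfl

end FiniteDual

/-! ### Bimeasurings -/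

section Bimeasuring

variable {k : Type*} [Field k]

/-- Let `N`, `T` be bialgebras and `A` an algebra. A bilinear map `ψ : N × T → A` is a *bimeasuring*
if `N` measures `T` to `A` and `T` measures `N` to `A`:
`ψ(nm, t) = ψ(n, t₁) ψ(m, t₂)`, `ψ(1, t) = ε(t)`,
`ψ(n, ts) = ψ(n₁, t) ψ(n₂, s)`, `ψ(n, 1) = ε(n)`. -/
structure IsBimeasuring {N T A : Type*} [Ring N] [Bialgebra k N] [Ring T] [Bialgebra k T]
    [Ring A] [Algebra k A] (ψ : N →ₗ[k] T →ₗ[k] A) : Prop where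
  mul_left : ∀ (n m : N) (t : T), ψ (n * m) t =
    LinearMap.mul' k A (TensorProduct.map (ψ n) (ψ m) (Coalgebra.comul t))
  one_left : ∀ t : T, ψ 1 t = algebraMap k A (Coalgebra.counit t)
  mul_right : ∀ (n : N) (t s : T), ψ n (t * s) =
    LinearMap.mul' k A (TensorProduct.map (ψ.flip t) (ψ.flip s) (Coalgebra.comul n))
  one_right : ∀ n : N, ψ n 1 = algebraMap k A (Coalgebra.counit n)

/-- A bimeasuring `θ : U × T → A` is *universal* if every bimeasuring `ψ : N × T → A` is of the form
`ψ(n, t) = θ(f(n), t)` for a unique bialgebra map `f : N → U`; then `U` is the universal bimeasuring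
bialgebra `B(T, A)`. Here `N` ranges over the bialgebras in an arbitrary universe `w`. -/
structure IsUniversalBimeasuring {U T A : Type*} [Ring U] [Bialgebra k U] [Ring T] [Bialgebra k T]
    [Ring A] [Algebra k A] (θ : U →ₗ[k] T →ₗ[k] A) : Prop where
  isBimeasuring : IsBimeasuring θ
  existsUnique : ∀ (N : Type w) [Ring N] [Bialgebra k N] (ψ : N →ₗ[k] T →ₗ[k] A),
    IsBimeasuring ψ → ∃! f : N →ₐc[k] U, ∀ (n : N) (t : T), ψ n t = θ (f n) t

end Bimeasuring

/-!
A bimeasuring `ψ : N × B → k` sends `n` to a functional `ψ(n, ·)` with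
`ψ(n, ab) = ∑ ψ(n₁, a) ψ(n₂, b)`. Hence the translates `ψ(n, · b)` span a finite-dimensional space,
the left ideal of those `b` with `ψ(n, · b) = 0` has finite codimension, and `B` acts on the quotient
by this left ideal through a finite-dimensional algebra through which `ψ(n, ·)` factors. So `ψ(n, ·)`
lies in `B°` (`IsRepresentative.of_map_mul`, `IsBimeasuring.isRepresentative`). The four axioms of a
bimeasuring then say exactly that `n ↦ ψ(n, ·)` is a map of bialgebras `N → B°`
(`IsBimeasuring.lift`), and it is the only one that induces `ψ` because `B° → B*` is injective.

Thus bialgebra maps `N → T°` are the same as bimeasurings `N × T → k`. This notion is symmetric in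
the two arguments, so exchanging them gives the bijection between bialgebra maps `T → N°` and
`N → T°` (`FiniteDual.transpose`), which is the self-adjunction of the finite dual.
-/

/-- If `f(ab)` is a finite sum of products `p(a) q(b)`, then `f` is representative. -/
theorem IsRepresentative.of_map_mul {k : Type*} [Field k] {B : Type*} [Ring B] [Algebra k B]
    (f : Module.Dual k B) (z : Module.Dual k B ⊗[k] Module.Dual k B)
    (hz : ∀ a b, f (a * b) = TensorProduct.dualDistrib k B B z (a ⊗ₜ b)) :
    IsRepresentative f := by
  classical
  -- the translates `a ↦ f(ab)`, as a linear map in `b`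
  let L : B →ₗ[k] Module.Dual k B := (LinearMap.llcomp k B B k f) ∘ₗ (LinearMap.mul k B).flip
  have hL : ∀ a b, L b a = f (a * b) := fun _ _ => rfl
  have hfin : FiniteDimensional k (LinearMap.range L) := by
    obtain ⟨s, hs⟩ := TensorProduct.exists_finset z
    have hle : LinearMap.range L ≤
        Submodule.span k ((s.image Prod.fst : Finset (Module.Dual k B)) : Set _) := by
      rintro _ ⟨b, rfl⟩
      have e : L b = ∑ i ∈ s, i.2 b • i.1 := by
        ext a
        rw [hL, hz, hs]
        simp [mul_comm]
      rw [e]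
      exact Submodule.sum_mem _ fun i hi => Submodule.smul_mem _ _
        (Submodule.subset_span (Finset.mem_coe.2 (Finset.mem_image_of_mem _ hi)))
    exact Submodule.finiteDimensional_of_le hle
  let J : Ideal B :=
    { carrier := {b | ∀ a, f (a * b) = 0}
      add_mem' := fun hx hy a => by rw [mul_add, map_add, hx a, hy a, add_zero]
      zero_mem' := fun a => by rw [mul_zero, map_zero]
      smul_mem' := fun c x hx a => by rw [smul_eq_mul, ← mul_assoc]; exact hx (a * c) }
  have hJ : J.restrictScalars k = LinearMap.ker L := by
    ext b
    exact ⟨fun h => LinearMap.ext h, fun h a => LinearMap.congr_fun h a⟩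
  have : FiniteDimensional k (B ⧸ J) := by
    change FiniteDimensional k (B ⧸ J.restrictScalars k)
    rw [hJ]
    exact Module.Finite.equiv L.quotKerEquivRange.symm
  refine IsRepresentative.of_factor (Algebra.lsmul k k (B ⧸ J)) f fun b hb => ?_
  -- an element that acts as zero kills the class of `1`, so it lies in the left ideal
  have h1 : b • (Submodule.Quotient.mk 1 : B ⧸ J) = 0 := LinearMap.congr_fun hb _
  rw [← Submodule.Quotient.mk_smul, Submodule.Quotient.mk_eq_zero, smul_eq_mul, mul_one] at h1
  simpa using h1 1

namespace IsBimeasuring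

variable {k : Type*} [Field k] {N T : Type*} [Ring N] [Bialgebra k N] [Ring T] [Bialgebra k T]

theorem flip {A : Type*} [Ring A] [Algebra k A] {ψ : N →ₗ[k] T →ₗ[k] A} (h : IsBimeasuring ψ) :
    IsBimeasuring ψ.flip where
  mul_left n m t := h.mul_right t n m
  one_left t := h.one_right t
  mul_right n t s := h.mul_left t s n
  one_right n := h.one_left n

theorem comp_bialgHom {A : Type*} [Ring A] [Algebra k A] {M : Type*} [Ring M] [Bialgebra k M]
    {ψ : N →ₗ[k] T →ₗ[k] A} (h : IsBimeasuring ψ) (g : M →ₐc[k] N) :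
    IsBimeasuring (ψ ∘ₗ (g : M →ₗc[k] N).toLinearMap) where
  mul_left n m t := by
    change ψ (g (n * m)) t = _
    rw [map_mul, h.mul_left]
    rfl
  one_left t := by
    change ψ (g 1) t = _
    rw [map_one, h.one_left]
  mul_right n t s := by
    change ψ (g n) (t * s) = _
    have e : ∀ t, (ψ ∘ₗ (g : M →ₗc[k] N).toLinearMap).flip t =
        ψ.flip t ∘ₗ (g : M →ₗc[k] N).toLinearMap := fun _ => rfl
    rw [h.mul_right, e, e, TensorProduct.map_comp, LinearMap.comp_apply]
    congr 2
    exact (CoalgHomClass.map_comp_comul_apply g n).symm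
  one_right n := by
    change ψ (g n) 1 = _
    rw [h.one_right]
    congr 1
    exact CoalgHomClass.counit_comp_apply g n

theorem isRepresentative {ψ : N →ₗ[k] T →ₗ[k] k} (h : IsBimeasuring ψ) (n : N) :
    IsRepresentative (ψ n) := by
  refine IsRepresentative.of_map_mul _ (TensorProduct.map ψ ψ (Coalgebra.comul n)) fun a b => ?_
  rw [h.mul_right]
  generalize (Coalgebra.comul n : N ⊗[k] N) = z
  induction z with
  | zero => simp
  | tmul p q => simp
  | add p q hp hq => simp only [map_add, LinearMap.add_apply, hp, hq]

end IsBimeasuring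

theorem FiniteDual.isBimeasuring_toDual (k : Type*) [Field k] (B : Type*) [Ring B]
    [Bialgebra k B] : IsBimeasuring (FiniteDual.toDual k B) where
  mul_left f g b := FiniteDual.toDual_mul f g b
  one_left b := FiniteDual.toDual_one b
  mul_right f a b := by
    rw [← FiniteDual.tensorToDual_comul]
    generalize (Coalgebra.comul f : FiniteDual k B ⊗[k] FiniteDual k B) = z
    induction z with
    | zero => simp
    | tmul p q => simp
    | add p q hp hq => simp only [map_add, LinearMap.add_apply, hp, hq]
  one_right f := (FiniteDual.counit_apply f).symm

namespace IsBimeasuring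

variable {k : Type*} [Field k] {N T : Type*} [Ring N] [Bialgebra k N] [Ring T] [Bialgebra k T]

/-- The algebra map `N → T°`, `n ↦ ψ(n, ·)`, of a bimeasuring `ψ : N × T → k`. -/
noncomputable def liftAlgHom {ψ : N →ₗ[k] T →ₗ[k] k} (h : IsBimeasuring ψ) :
    N →ₐ[k] FiniteDual k T :=
  AlgHom.ofLinearMap
    { toFun := fun n => FiniteDual.mk (ψ n) (h.isRepresentative n)
      map_add' := fun x y => FiniteDual.toDual_injective (ψ.map_add x y)
      map_smul' := fun c x => FiniteDual.toDual_injective (ψ.map_smul c x) }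
    (FiniteDual.ext' fun t => h.one_left t)
    (fun n m => FiniteDual.ext' fun t => h.mul_left n m t)

theorem toDual_liftAlgHom {ψ : N →ₗ[k] T →ₗ[k] k} (h : IsBimeasuring ψ) (n : N) :
    FiniteDual.toDual k T (h.liftAlgHom n) = ψ n := rfl

/-- The bialgebra map `N → T°`, `n ↦ ψ(n, ·)`, of a bimeasuring `ψ : N × T → k`. -/
noncomputable def lift {ψ : N →ₗ[k] T →ₗ[k] k} (h : IsBimeasuring ψ) : N →ₐc[k] FiniteDual k T :=
  BialgHom.ofAlgHom h.liftAlgHom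
    (by
      ext n
      exact h.one_right n)
    (by
      have key : ∀ (z : N ⊗[k] N) (a b : T),
          FiniteDual.tensorToDual k T
            (Algebra.TensorProduct.map h.liftAlgHom h.liftAlgHom z) (a ⊗ₜ b) =
            LinearMap.mul' k k (TensorProduct.map (ψ.flip a) (ψ.flip b) z) := by
        intro z a b
        induction z with
        | zero => simp
        | tmul p q => rfl
        | add p q hp hq => simp only [map_add, LinearMap.add_apply, hp, hq]
      refine AlgHom.ext fun n => FiniteDual.tensorToDual_injective
        (TensorProduct.ext (LinearMap.ext fun a => LinearMap.ext fun b => ?_))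
      refine (key (Coalgebra.comul n) a b).trans ?_
      refine Eq.trans ?_ (FiniteDual.tensorToDual_comul (h.liftAlgHom n) a b).symm
      rw [toDual_liftAlgHom, h.mul_right])

theorem toDual_lift {ψ : N →ₗ[k] T →ₗ[k] k} (h : IsBimeasuring ψ) (n : N) :
    FiniteDual.toDual k T (h.lift n) = ψ n := rfl

end IsBimeasuring

theorem FiniteDual.isUniversalBimeasuring_toDual (k : Type u) [Field k] (B : Type v) [Ring B]
    [Bialgebra k B] : IsUniversalBimeasuring.{w} (FiniteDual.toDual k B) where
  isBimeasuring := FiniteDual.isBimeasuring_toDual k B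
  existsUnique N _ _ ψ hψ := by
    refine ⟨hψ.lift, fun n t => by rw [hψ.toDual_lift], fun g hg => ?_⟩
    refine BialgHom.ext fun n => FiniteDual.ext' fun t => ?_
    rw [← hg, hψ.toDual_lift]

/-- The transpose `n ↦ (t ↦ g(t)(n))` of a bialgebra map `g : T → N°`. -/
noncomputable def FiniteDual.transpose {k : Type*} [Field k] {N T : Type*} [Ring N]
    [Bialgebra k N] [Ring T] [Bialgebra k T] (g : T →ₐc[k] FiniteDual k N) :
    N →ₐc[k] FiniteDual k T :=
  ((FiniteDual.isBimeasuring_toDual k N).comp_bialgHom g).flip.lift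

theorem FiniteDual.toDual_transpose {k : Type*} [Field k] {N T : Type*} [Ring N]
    [Bialgebra k N] [Ring T] [Bialgebra k T] (g : T →ₐc[k] FiniteDual k N) (n : N) (t : T) :
    FiniteDual.toDual k T (FiniteDual.transpose g n) t = FiniteDual.toDual k N (g t) n := rfl

/-- Transposition as a bijection between the bialgebra maps `T → N°`, written as morphisms `N° ⟶ T`
in the opposite category, and the bialgebra maps `N → T°`. -/
noncomputable def finiteDualHomEquiv (k : Type u) [Field k] (N : BialgCat.{max u v} k)
    (T : (BialgCat.{max u v} k)ᵒᵖ) :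
    ((finiteDualFunctor.{u, v} k).rightOp.obj N ⟶ T) ≃
      (N ⟶ (finiteDualFunctor.{u, v} k).obj T) where
  toFun f := BialgCat.ofHom (FiniteDual.transpose (N := N) (T := T.unop) f.unop.toBialgHom)
  invFun g := Quiver.Hom.op
    (BialgCat.ofHom (FiniteDual.transpose (N := T.unop) (T := N) g.toBialgHom))
  left_inv _ := rfl
  right_inv _ := rfl

/-- The self-adjunction of the finite dual, given on Hom sets by transposition. -/
noncomputable def finiteDualAdjunction (k : Type u) [Field k] :
    (finiteDualFunctor.{u, v} k).rightOp ⊣ finiteDualFunctor.{u, v} k :=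
  Adjunction.mkOfHomEquiv
    { homEquiv := finiteDualHomEquiv.{u, v} k
      homEquiv_naturality_left_symm := fun _ _ => rfl
      homEquiv_naturality_right := fun _ _ => rfl }

theorem mainTheorem3 (k : Type u) [Field k] :
    -- `B°` with the evaluation pairing is the universal bimeasuring bialgebra `B(B, k)`
    (∀ (B : Type v) [Ring B] [Bialgebra k B],
      IsUniversalBimeasuring.{w} (FiniteDual.toDual k B)) ∧
    -- `B ↦ B°` is adjoint to itself; the bijection `Hom(T, N°) ≃ Hom(N, T°)` is transposition
    ∃ adj : (finiteDualFunctor.{u, v} k).rightOp ⊣ finiteDualFunctor.{u, v} k,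
      ∀ (N T : BialgCat.{max u v} k)
        (f : T ⟶ (finiteDualFunctor.{u, v} k).obj (Opposite.op N)) (n : N) (t : T),
        FiniteDual.toDual k T ((adj.homEquiv N (Opposite.op T) f.op).toBialgHom n) t =
          FiniteDual.toDual k N (f.toBialgHom t) n := by
  refine ⟨fun B _ _ => FiniteDual.isUniversalBimeasuring_toDual k B,
    finiteDualAdjunction.{u, v} k, fun N T f n t => ?_⟩
  rw [finiteDualAdjunction, Adjunction.mkOfHomEquiv_homEquiv]
  exact FiniteDual.toDual_transpose (N := N) (T := T) f.toBialgHom n t
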